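/- Let $\Delta=\Delta_1\sqcup\dots\sqcup\Delta_m$ be a Dynkin diagram whose connected components $\Delta_i$ are each of type $\mathbf B_{l_i}$ with $l_i\ge 1$ or of type $\mathbf D_{l_i}$ with $l_i\ge 3$ (so $\mathbf B_1=\mathbf A_1$ and $\mathbf D_3=\mathbf A_3$ are allowed). Let $S_i$ be a set with $l_i$ elements, let $S=S_1\sqcup\dots\sqcup S_m$, and let $V=\bigoplus_i\mathbb Q^{S_i}$ with standard basis $(\varepsilon_s)_{s\in S}$ and standard scalar product $(\,,)$. Realize the root system of $\Delta$ in $V$ in the standard way: the roots are the vectors $\pm\varepsilon_s\pm\varepsilon_t$ with $s\ne t$ in the same $S_i$, together with the vectors $\pm\varepsilon_s$, $s\in S_i$, for those $i$ with $\Delta_i$ of type $\mathbf B_{l_i}$. Let $W=W(\Delta)$ be its Weyl group, that is, the finite group generated by the reflections $x\mapsto x-\frac{2(x,\alpha)}{(\alpha,\alpha)}\alpha$ in the roots $\alpha$. Let $M\subset V$ be the additive subgroup generated by all $\varepsilon_s$, $s\in S$, and by $\beta=\frac12\sum_{s\in S}\varepsilon_s$; it is stable under the natural action of $W$. For a finite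 group $\Gamma$, a $\Gamma$-lattice is a finitely generated free abelian group with a linear action of $\Gamma$. It is called permutation if it has a $\mathbb Z$-basis permuted by $\Gamma$. A $\Gamma$-lattice $L$ is called quasi-permutation if there is a short exact sequence of $\Gamma$-lattices $0\to L\to P\to P'\to 0$ with $P$ and $P'$ permutation, and quasi-invertible if it is a direct summand of a quasi-permutation $\Gamma$-lattice. If the number of vertices satisfies $|\Delta|=\sum_i l_i\ge 3$, then the $W$-lattice $M$ is not quasi-invertible. -/

import Mathlib

/-! ### Permutation, quasi-permutation and quasi-invertible lattices

A `G`-lattice is a finitely generated free abelian group `L` with an integral representation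
`Representation ℤ G L`; here `G` is a finite group. -/

namespace GLattice

universe u v

variable {G : Type v} [Group G]

/-- A `G`-lattice is permutation if it has a (finite) `ℤ`-basis that is permuted by `G`. -/
def IsPermutation {P : Type u} [AddCommGroup P] (ρ : Representation ℤ G P) : Prop :=
  ∃ (n : ℕ) (b : Module.Basis (Fin n) ℤ P), ∀ (g : G) (i : Fin n), ∃ j : Fin n, ρ g (b i) = b j

/-- A `G`-lattice `L` is quasi-permutation if there is a short exact sequence of `G`-lattices
`0 → L → P → P' → 0` in which `P` and `P'` are permutation lattices. -/
def IsQuasiPermutation {L : Type u} [AddCommGroup L] (ρ : Representation ℤ G L) : Prop :=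
  ∃ (P : Type u) (_ : AddCommGroup P) (σ : Representation ℤ G P)
    (P' : Type u) (_ : AddCommGroup P') (σ' : Representation ℤ G P')
    (f : Representation.IntertwiningMap ρ σ) (p : Representation.IntertwiningMap σ σ'),
    IsPermutation σ ∧ IsPermutation σ' ∧
      Function.Injective f ∧ Function.Exact f p ∧ Function.Surjective p

/-- A `G`-lattice `L` is quasi-invertible if it is a direct summand of a quasi-permutation
`G`-lattice, that is, if `L ⊕ L'` is quasi-permutation for some `G`-lattice `L'`. -/
def IsQuasiInvertible {L : Type u} [AddCommGroup L] (ρ : Representation ℤ G L) : Prop :=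
  ∃ (L' : Type u) (_ : AddCommGroup L') (_ : Module.Free ℤ L') (_ : Module.Finite ℤ L')
    (ρ' : Representation ℤ G L'), IsQuasiPermutation (ρ.prod ρ')

end GLattice

/-! ### Root systems with components of type `B` and `D`, and the lattice `M` -/

namespace BDDiagram

/-- A connected Dynkin diagram of type `B_l` with `l ≥ 1` (so `B_1 = A_1` is allowed) or of type
`D_l` with `l ≥ 3` (so `D_3 = A_3` is allowed). -/
inductive Component : Type
  | B (l : ℕ) (hl : 1 ≤ l) : Component
  | D (l : ℕ) (hl : 3 ≤ l) : Component

/-- The number of vertices of a component. -/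
def Component.rank : Component → ℕ
  | .B l _ => l
  | .D l _ => l

/-- The predicate that a component is of type `B`. -/
def Component.IsB : Component → Prop
  | .B _ _ => True
  | .D _ _ => False

variable {m : ℕ} (Δ : Fin m → Component)

/-- The number `|Δ|` of vertices of the Dynkin diagram `Δ = Δ₁ ∪ ⋯ ∪ Δₘ`. -/
def card : ℕ := ∑ i, (Δ i).rank

/-- The index set `S`: the disjoint union of the sets `Sᵢ`, where `Sᵢ` has `lᵢ` elements. -/
abbrev Idx : Type := Σ i : Fin m, Fin (Δ i).rank

/-- The vector space `V = ⨁ Vᵢ` over `ℚ` with standard basis indexed by `S`. -/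
abbrev Space : Type := Idx Δ → ℚ

/-- The standard basis vector `ε_s`. -/
def ε (s : Idx Δ) : Space Δ := Pi.single s 1

/-- The roots in the standard realization: for each component `Δᵢ` the vectors `± ε_s ± ε_t` with
`s ≠ t` in `Sᵢ`, and, if `Δᵢ` is of type `B`, also the vectors `± ε_s` with `s` in `Sᵢ`. -/
def roots : Set (Space Δ) :=
  {α | ∃ (i : Fin m) (s t : Fin (Δ i).rank) (a b : ℤˣ), s ≠ t ∧
      α = ((a : ℤ) : ℚ) • ε Δ ⟨i, s⟩ + ((b : ℤ) : ℚ) • ε Δ ⟨i, t⟩} ∪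
  {α | ∃ (i : Fin m) (s : Fin (Δ i).rank) (a : ℤˣ), (Δ i).IsB ∧
      α = ((a : ℤ) : ℚ) • ε Δ ⟨i, s⟩}

open scoped Matrix in
/-- The Weyl group `W = W(Δ)`: the group of automorphisms of `V` generated by the reflections
`x ↦ x - (2 (x, α) / (α, α)) α` in the roots `α`, with `( , )` the standard scalar product. -/
def weylGroup : Subgroup (Space Δ ≃ₗ[ℚ] Space Δ) :=
  Subgroup.closure {w | ∃ α ∈ roots Δ, ∀ x, w x = x - (2 * (x ⬝ᵥ α) / (α ⬝ᵥ α)) • α}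

/-- The vector `β = ½ ∑ ε_s`. -/
def β : Space Δ := (1 / 2 : ℚ) • ∑ s, ε Δ s

/-- The additive subgroup `M` of `V` generated by `β` and all the `ε_s`. -/
def M : Submodule ℤ (Space Δ) := Submodule.span ℤ (insert (β Δ) (Set.range (ε Δ)))

/-- The natural action of `W` on `V`, regarded as an abelian group. -/
def spaceRep : Representation ℤ (weylGroup Δ) (Space Δ) where
  toFun w := (w : Space Δ ≃ₗ[ℚ] Space Δ).toLinearMap.restrictScalars ℤ
  map_one' := rfl
  map_mul' _ _ := rfl

theorem β_apply (s : Idx Δ) : β Δ s = 1 / 2 := by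
  simp [β, ε, Finset.sum_apply, Pi.single_apply]

theorem ε_mem (s : Idx Δ) : ε Δ s ∈ M Δ :=
  Submodule.subset_span (Set.mem_insert_of_mem _ ⟨s, rfl⟩)

theorem unit_smul_ε_mem (a : ℤˣ) (s : Idx Δ) : ((a : ℤ) : ℚ) • ε Δ s ∈ M Δ := by
  rw [Int.cast_smul_eq_zsmul]
  exact (M Δ).smul_mem _ (ε_mem Δ s)

theorem coord_of_mem {x : Space Δ} (hx : x ∈ M Δ) :
    ∃ (k : ℤ) (c : Idx Δ → ℤ), ∀ s, x s = k / 2 + c s := by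
  induction hx using Submodule.span_induction with
  | mem x h =>
    rcases h with rfl | ⟨t, rfl⟩
    · exact ⟨1, fun _ => 0, fun s => by rw [β_apply]; simp⟩
    · exact ⟨0, Pi.single t 1, fun s => by
        by_cases h : s = t <;> simp [ε, h]⟩
  | zero => exact ⟨0, fun _ => 0, fun s => by simp⟩
  | add x y _ _ hx hy =>
    obtain ⟨k, c, h⟩ := hx
    obtain ⟨k', c', h'⟩ := hy
    exact ⟨k + k', c + c', fun s => by simp [h, h']; ring⟩
  | smul n x _ hx =>
    obtain ⟨k, c, h⟩ := hx
    exact ⟨n * k, n • c, fun s => by simp [h]; ring⟩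

open scoped Matrix in
/-- A reflection in a root maps `M` into itself. -/
theorem reflection_mem {α x : Space Δ} (hα : α ∈ roots Δ) (hx : x ∈ M Δ) :
    x - (2 * (x ⬝ᵥ α) / (α ⬝ᵥ α)) • α ∈ M Δ := by
  obtain ⟨k, c, h⟩ := coord_of_mem Δ hx
  suffices hs : α ∈ M Δ ∧ ∃ n : ℤ, 2 * (x ⬝ᵥ α) / (α ⬝ᵥ α) = n by
    obtain ⟨hαM, n, hn⟩ := hs
    rw [hn, Int.cast_smul_eq_zsmul]
    exact (M Δ).sub_mem hx ((M Δ).smul_mem _ hαM)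
  rcases hα with ⟨i, s, t, a, b, hst, rfl⟩ | ⟨i, s, a, -, rfl⟩
  · refine ⟨(M Δ).add_mem (unit_smul_ε_mem Δ _ _) (unit_smul_ε_mem Δ _ _), ?_⟩
    have h1 : (⟨i, s⟩ : Idx Δ) ≠ ⟨i, t⟩ := by simpa using hst
    rcases Int.units_eq_one_or a with rfl | rfl <;> rcases Int.units_eq_one_or b with rfl | rfl
    · exact ⟨k + c ⟨i, s⟩ + c ⟨i, t⟩, by simp [ε, h, h1, h1.symm]; ring⟩
    · exact ⟨c ⟨i, s⟩ - c ⟨i, t⟩, by simp [ε, h, h1, h1.symm]; ring⟩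
    · exact ⟨c ⟨i, t⟩ - c ⟨i, s⟩, by simp [ε, h, h1, h1.symm]; ring⟩
    · exact ⟨-k - c ⟨i, s⟩ - c ⟨i, t⟩, by simp [ε, h, h1, h1.symm]; ring⟩
  · refine ⟨unit_smul_ε_mem Δ _ _, ?_⟩
    rcases Int.units_eq_one_or a with rfl | rfl
    · exact ⟨k + 2 * c ⟨i, s⟩, by simp [ε, h]; ring⟩
    · exact ⟨-k - 2 * c ⟨i, s⟩, by simp [ε, h]; ring⟩

/-- The Weyl group preserves `M`. -/
theorem M_le_comap (w : weylGroup Δ) : M Δ ≤ (M Δ).comap (spaceRep Δ w) := by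
  obtain ⟨w, hw⟩ := w
  have key : ∀ x, x ∈ M Δ ↔ w x ∈ M Δ := by
    induction hw using Subgroup.closure_induction with
    | mem w h =>
      obtain ⟨α, hα, h⟩ := h
      have hmem : ∀ x, x ∈ M Δ → w x ∈ M Δ := fun x hx => h x ▸ reflection_mem Δ hα hx
      have hww : ∀ x, w (w x) = x := by
        intro x
        have hαα : α ⬝ᵥ α = 0 ∨ α ⬝ᵥ α ≠ 0 := em _
        rw [h (w x), h x]
        rcases hαα with h0 | h0
        · simp [h0]
        · simp only [sub_dotProduct, smul_dotProduct, smul_eq_mul]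
          field_simp
          module
      exact fun x => ⟨hmem x, fun hx => hww x ▸ hmem _ hx⟩
    | one => exact fun x => Iff.rfl
    | mul w w' _ _ hw hw' => exact fun x => (hw' x).trans (hw _)
    | inv w _ hw =>
      intro x
      rw [hw (w⁻¹ x)]
      exact iff_of_eq (congrArg (· ∈ M Δ) (w.apply_symm_apply x).symm)
  exact fun x hx => (key x).1 hx

/-- The `W`-lattice `M`: the natural action of `W` on `M`. -/
noncomputable def latticeRep : Representation ℤ (weylGroup Δ) (M Δ) :=
  (spaceRep Δ).subrepresentation (M Δ) (M_le_comap Δ)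

instance : Module.Finite ℤ (M Δ) :=
  Module.Finite.iff_fg.2 (Submodule.fg_span ((Set.finite_range _).insert _))

instance : Module.Free ℤ (M Δ) := inferInstance

/-- A reflection in a root sends each `ε_s` to some `± ε_t`. -/
theorem reflection_ε {α : Space Δ} (hα : α ∈ roots Δ) (s : Idx Δ) :
    ∃ (a : ℤˣ) (t : Idx Δ),
      ε Δ s - (2 * (ε Δ s ⬝ᵥ α) / (α ⬝ᵥ α)) • α = ((a : ℤ) : ℚ) • ε Δ t := by
  rcases hα with ⟨i, u, v, a, b, huv, rfl⟩ | ⟨i, u, a, -, rfl⟩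
  · have h1 : (⟨i, u⟩ : Idx Δ) ≠ ⟨i, v⟩ := by simpa using huv
    generalize (⟨i, u⟩ : Idx Δ) = u' at h1 ⊢
    generalize (⟨i, v⟩ : Idx Δ) = v' at h1 ⊢
    have ha : ((a : ℤ) : ℚ) * ((a : ℤ) : ℚ) = 1 := by
      rcases Int.units_eq_one_or a with rfl | rfl <;> simp
    have hb : ((b : ℤ) : ℚ) * ((b : ℤ) : ℚ) = 1 := by
      rcases Int.units_eq_one_or b with rfl | rfl <;> simp
    have hn : (((a : ℤ) : ℚ) • ε Δ u' + ((b : ℤ) : ℚ) • ε Δ v') ⬝ᵥ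
        (((a : ℤ) : ℚ) • ε Δ u' + ((b : ℤ) : ℚ) • ε Δ v') = 2 := by
      simp [ε, h1, h1.symm, ha, hb]; norm_num
    rw [hn]
    by_cases hu : s = u'
    · subst hu
      refine ⟨-(a * b), v', ?_⟩
      simp only [ε, dotProduct_add, dotProduct_smul, single_dotProduct]
      simp [h1, smul_smul, ha]
    · by_cases hv : s = v'
      · subst hv
        refine ⟨-(a * b), u', ?_⟩
        simp only [ε, dotProduct_add, dotProduct_smul, single_dotProduct]
        simp [h1.symm, smul_smul, hb, mul_comm]
      · refine ⟨1, s, ?_⟩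
        simp [ε, hu, hv]
  · generalize (⟨i, u⟩ : Idx Δ) = u'
    have ha : ((a : ℤ) : ℚ) * ((a : ℤ) : ℚ) = 1 := by
      rcases Int.units_eq_one_or a with rfl | rfl <;> simp
    by_cases hu : s = u'
    · subst hu
      refine ⟨-1, s, ?_⟩
      simp [ε, smul_smul, ha, mul_assoc]
      module
    · exact ⟨1, s, by simp [ε, hu]⟩

/-- The finite set of vectors `± ε_s`. -/
def signedBasis : Set (Space Δ) :=
  Set.range fun p : ℤˣ × Idx Δ => ((p.1 : ℤ) : ℚ) • ε Δ p.2

theorem signedBasis_finite : (signedBasis Δ).Finite := Set.finite_range _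

theorem weylGroup_mapsTo {w : Space Δ ≃ₗ[ℚ] Space Δ} (hw : w ∈ weylGroup Δ) :
    Set.MapsTo w (signedBasis Δ) (signedBasis Δ) := by
  induction hw using Subgroup.closure_induction with
  | mem w h =>
    obtain ⟨α, hα, h⟩ := h
    rintro _ ⟨⟨b, s⟩, rfl⟩
    obtain ⟨a, t, hat⟩ := reflection_ε Δ hα s
    exact ⟨⟨b * a, t⟩, by
      change _ = w (((b : ℤ) : ℚ) • ε Δ s)
      rw [map_smul, h, hat, smul_smul]
      push_cast
      rfl⟩
  | one => exact fun x hx => hx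
  | mul w w' _ _ hw hw' => exact hw.comp hw'
  | inv w _ hw =>
    intro x hx
    have := (signedBasis_finite Δ).to_subtype
    obtain ⟨y, hy⟩ := Finite.surjective_of_injective
      (hw.restrict_inj.2 w.injective.injOn) ⟨x, hx⟩
    have hy' : w y = x := congrArg Subtype.val hy
    have : w⁻¹ x = y := by rw [← hy']; exact w.symm_apply_apply _
    rw [this]
    exact y.2

/-- The Weyl group is finite. -/
instance : Finite (weylGroup Δ) := by
  have := (signedBasis_finite Δ).to_subtype
  have hε : ∀ s, ε Δ s ∈ signedBasis Δ := fun s => ⟨⟨1, s⟩, by simp⟩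
  refine Finite.of_injective
    (fun (w : weylGroup Δ) (s : Idx Δ) =>
      (⟨w.1 (ε Δ s), weylGroup_mapsTo Δ w.2 (hε s)⟩ : signedBasis Δ)) fun w w' h => ?_
  refine Subtype.ext (LinearEquiv.toLinearMap_injective ((Pi.basisFun ℚ (Idx Δ)).ext fun s => ?_))
  have h2 := congrArg Subtype.val (congrFun h s)
  simpa [ε, Pi.basisFun_apply] using h2

end BDDiagram

/-! The obstruction is cohomological. Let `Γ → G` be a homomorphism and `L` a quasi-invertible
`G`-lattice. A cocycle `Γ → L` modulo `N` that is a coboundary modulo `N` at each single element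
must lift to an integral cocycle (`IsQuasiInvertible.exists_cocycle`); otherwise its Bockstein would
be a nonzero class in `H²(Γ, L)` vanishing on cyclic subgroups. This reduces to permutation
lattices: there such a cocycle is a coboundary modulo `N`, and invariants modulo `N` lift.

It remains to find `Γ → W` and a cocycle on `M` that does not lift. In general `Γ` is a Klein
four-group of sign changes in which all three nontrivial characters occur, with `N = 4`. The
half-integral `β` makes the cocycle locally trivial, while integrality of coordinate differences in
`M` forbids a lift. Parity of signs on `D` components excludes this choice only for a single `D_4`.
There `M` is the Hurwitz order, on which the quaternion group acts by left multiplication, and `N =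
2` works. -/

namespace GLattice

universe u v w

/-! ### Permutation lattices modulo `N` -/

section Permutation

variable {Γ : Type w} [Group Γ] {P : Type u} [AddCommGroup P] {σ : Representation ℤ Γ P}

theorem IsPermutation.comp {G : Type v} [Group G] {σ : Representation ℤ G P}
    (h : IsPermutation σ) (φ : Γ →* G) : IsPermutation (σ.comp φ) := by
  obtain ⟨n, b, hb⟩ := h
  exact ⟨n, b, fun g i => hb (φ g) i⟩

/-- A permutation lattice has a basis indexed by a set on which the group acts, and the coordinates
are permuted accordingly. -/
theorem IsPermutation.exists_mulAction (h : IsPermutation σ) :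
    ∃ (n : ℕ) (b : Module.Basis (Fin n) ℤ P) (_ : MulAction Γ (Fin n)),
      ∀ (g : Γ) (x : P) (i : Fin n), b.repr (σ g x) i = b.repr x (g⁻¹ • i) := by
  obtain ⟨n, b, hb⟩ := h
  choose π hπ using hb
  let act : MulAction Γ (Fin n) :=
    { smul := π
      one_smul := fun i => b.injective (by
        change b (π 1 i) = b i
        rw [← hπ, map_one]; rfl)
      mul_smul := fun g h i => b.injective (by
        change b (π (g * h) i) = b (π g (π h i))
        rw [← hπ, ← hπ, ← hπ, map_mul]; rfl) }
  have hact : ∀ (g : Γ) (i : Fin n), σ g (b i) = b (g • i) := hπ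
  refine ⟨n, b, act, fun g x i => ?_⟩
  have h1 : Finsupp.lapply i ∘ₗ b.repr.toLinearMap ∘ₗ σ g =
      Finsupp.lapply (g⁻¹ • i) ∘ₗ b.repr.toLinearMap := b.ext fun j => by
    change b.repr (σ g (b j)) i = b.repr (b j) (g⁻¹ • i)
    rw [hact, b.repr_self, b.repr_self, Finsupp.single_apply, Finsupp.single_apply]
    simp only [eq_inv_smul_iff]
  exact LinearMap.congr_fun h1 x

theorem exists_eq_smul_of_dvd_repr {ι : Type*} [Finite ι] (b : Module.Basis ι ℤ P) {N : ℤ} {x : P}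
    (h : ∀ i, N ∣ b.repr x i) : ∃ y, x = N • y := by
  choose k hk using h
  refine ⟨b.equivFun.symm k, b.equivFun.injective ?_⟩
  ext i
  simp [hk]

theorem IsPermutation.smul_right_injective (h : IsPermutation σ) {N : ℤ} (hN : N ≠ 0) :
    Function.Injective fun x : P => N • x := by
  obtain ⟨n, b, -⟩ := h
  intro x y hxy
  refine b.ext_elem fun i => mul_left_cancel₀ hN ?_
  simpa using congrArg (fun z => b.repr z i) hxy

/-- A cocycle modulo `N` with values in a permutation lattice is a coboundary modulo `N` as soon as
its restrictions to cyclic subgroups are. -/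
theorem IsPermutation.exists_coboundary (h : IsPermutation σ) {N : ℤ} {c : Γ → P}
    (hc : ∀ g h, ∃ m, c (g * h) = c g + σ g (c h) + N • m)
    (hloc : ∀ g, ∃ z m, c g = σ g z - z + N • m) :
    ∃ v, ∀ g, ∃ m, c g = σ g v - v + N • m := by
  -- Shapiro's lemma by hand: on each orbit the class is a homomorphism from a stabilizer to `ℤ/N`,
  -- and it is zero because it vanishes at every element.
  obtain ⟨n, b, _, hb⟩ := h.exists_mulAction
  let r : Fin n → Fin n := fun i => (Quotient.mk (MulAction.orbitRel Γ (Fin n)) i).out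
  have hr : ∀ i, ∃ g : Γ, g • r i = i := fun i =>
    MulAction.orbitRel_apply.1 ((MulAction.orbitRel Γ (Fin n)).symm
      (Quotient.mk_out (s := MulAction.orbitRel Γ (Fin n)) i))
  have hr' : ∀ (g : Γ) i, r (g • i) = r i := fun g i =>
    congrArg Quotient.out (Quotient.sound (s := MulAction.orbitRel Γ (Fin n))
      (MulAction.orbitRel_apply.2 ⟨g, rfl⟩))
  choose t ht using hr
  have hcoord : ∀ g h i, N ∣ b.repr (c (g * h)) i - b.repr (c g) i - b.repr (c h) (g⁻¹ • i) := by
    intro g h i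
    obtain ⟨m, hm⟩ := hc g h
    refine ⟨b.repr m i, ?_⟩
    rw [hm]
    simp only [map_add, map_zsmul, Finsupp.add_apply, Finsupp.smul_apply, hb, smul_eq_mul]
    ring
  have hfix : ∀ (g : Γ) i, g • i = i → N ∣ b.repr (c g) i := by
    intro g i hgi
    obtain ⟨z, m, hm⟩ := hloc g
    refine ⟨b.repr m i, ?_⟩
    rw [hm]
    simp [hb, inv_smul_eq_iff.2 hgi.symm]
  let v : P := b.equivFun.symm fun i => -b.repr (c (t i)) i
  have hv : ∀ i, b.repr v i = -b.repr (c (t i)) i := fun i =>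
    congrFun (b.equivFun.apply_symm_apply _) i
  refine ⟨v, fun g => ?_⟩
  suffices hs : ∃ m, c g - (σ g v - v) = N • m by
    obtain ⟨m, hm⟩ := hs
    exact ⟨m, by rw [← hm]; abel⟩
  refine exists_eq_smul_of_dvd_repr b fun i => ?_
  set j := g⁻¹ • i with hj
  have hrj : r j = r i := hr' _ _
  -- `k` fixes the orbit representative; expanding `c (g * t j) = c (t i * k)` both ways leaves only
  -- the coordinate of `c k` there, which `hfix` kills.
  let k : Γ := (t i)⁻¹ * (g * t j)
  have hk : k • r i = r i := by
    rw [mul_smul, mul_smul, inv_smul_eq_iff, ht i]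
    nth_rewrite 1 [← hrj]
    rw [ht j, hj, smul_inv_smul]
  have h1 := hcoord g (t j) i
  have h2 := hcoord (t i) k i
  have h3 := hfix k _ hk
  have h4 : (t i)⁻¹ • i = r i := inv_smul_eq_iff.2 (ht i).symm
  rw [h4, show t i * k = g * t j by simp [k]] at h2
  rw [← hj] at h1
  have h5 : b.repr (c g - (σ g v - v)) i =
      (b.repr (c (g * t j)) i - b.repr (c (t i)) i - b.repr (c k) (r i)) + b.repr (c k) (r i) -
      (b.repr (c (g * t j)) i - b.repr (c g) i - b.repr (c (t j)) j) := by
    simp only [map_sub, Finsupp.coe_sub, Pi.sub_apply, hb, hv, ← hj]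
    ring
  rw [h5]
  exact dvd_sub (dvd_add h2 h3) h1

/-- Invariants of a permutation lattice modulo `N` lift to invariants. -/
theorem IsPermutation.exists_invariant (h : IsPermutation σ) {N : ℤ} {x : P}
    (hx : ∀ g, ∃ m, σ g x - x = N • m) : ∃ u m, (∀ g, σ g u = u) ∧ x = u + N • m := by
  obtain ⟨n, b, _, hb⟩ := h.exists_mulAction
  -- Coordinates congruent along orbits have equal residues.
  let u : P := b.equivFun.symm fun i => b.repr x i % N
  have hu : ∀ i, b.repr u i = b.repr x i % N := fun i =>
    congrFun (b.equivFun.apply_symm_apply _) i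
  have h1 : ∃ m, x - u = N • m := exists_eq_smul_of_dvd_repr b fun i => by
    rw [map_sub, Finsupp.sub_apply, hu]
    exact Int.dvd_self_sub_emod
  obtain ⟨m, hm⟩ := h1
  refine ⟨u, m, fun g => b.ext_elem fun i => ?_, by rw [← hm]; abel⟩
  obtain ⟨k, hk⟩ := hx g
  rw [hb, hu, hu]
  refine (Int.modEq_iff_dvd.2 ⟨b.repr k i, ?_⟩ : b.repr x i ≡ _ [ZMOD N]).symm
  have := congrArg (fun z => b.repr z i) hk
  simpa [hb] using this

end Permutation

/-! ### Lifting cocycles modulo `N` -/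

variable {G : Type v} [Group G] {Γ : Type w} [Group Γ] (φ : Γ →* G)
  {L : Type u} [AddCommGroup L] {ρ : Representation ℤ G L}

/-- For a quasi-permutation lattice, a cocycle modulo `N` that is locally a coboundary modulo `N`
lifts to a cocycle. -/
theorem IsQuasiPermutation.exists_cocycle (h : IsQuasiPermutation ρ) {N : ℤ} (hN : N ≠ 0)
    {c : Γ → L} (hc : ∀ g h, ∃ m, c (g * h) = c g + ρ (φ g) (c h) + N • m)
    (hloc : ∀ g, ∃ z m, c g = ρ (φ g) z - z + N • m) :
    ∃ d : Γ → L, (∀ g h, d (g * h) = d g + ρ (φ g) (d h)) ∧ ∀ g, ∃ m, d g = c g + N • m := by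
  obtain ⟨P, _, σ, P', _, σ', f, p, hP, hP', hf, hex, hp⟩ := h
  have hfσ : ∀ g x, f (ρ g x) = σ g (f x) := fun g x => f.isIntertwining _ _ g x
  have hpσ : ∀ g x, p (σ g x) = σ' g (p x) := fun g x => p.isIntertwining _ _ g x
  obtain ⟨v, hv⟩ := (hP.comp φ).exists_coboundary (N := N) (c := fun g => f (c g))
    (fun g h => by
      obtain ⟨m, hm⟩ := hc g h
      exact ⟨f m, by simp [hm, hfσ]⟩)
    (fun g => by
      obtain ⟨z, m, hm⟩ := hloc g
      exact ⟨f z, f m, by simp [hm, hfσ]⟩)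
  have hpf : ∀ x, p (f x) = 0 := fun x => (hex _).2 ⟨x, rfl⟩
  obtain ⟨u, t, hu, ht⟩ := (hP'.comp φ).exists_invariant (N := N) (x := p v) (fun g => by
    obtain ⟨m, hm⟩ := hv g
    refine ⟨-p m, ?_⟩
    have h1 := hpf (c g)
    rw [hm, map_add, map_sub, map_zsmul] at h1
    change p (σ (φ g) v) - p v + N • p m = 0 at h1
    rw [hpσ] at h1
    change σ' (φ g) (p v) - p v = _
    rw [smul_neg]
    exact eq_neg_of_add_eq_zero_left h1)
  -- Correcting `v` by `N • s` makes its image in `P'` truly invariant, so its coboundary takes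
  -- values in `L`; this is `d`.
  obtain ⟨s, hs⟩ := hp t
  have hpv : p (v - N • s) = u := by rw [map_sub, map_zsmul, hs, ht]; abel
  have hd : ∀ g, ∃ x, f x = σ (φ g) (v - N • s) - (v - N • s) := fun g =>
    (hex _).1 (by rw [map_sub, hpσ, hpv]; exact sub_eq_zero.2 (hu g))
  choose d hd using hd
  refine ⟨d, fun g h => hf ?_, fun g => ?_⟩
  · rw [map_add, hfσ, hd, hd, hd, map_mul, map_mul, Module.End.mul_apply]
    generalize v - N • s = q
    rw [map_sub]
    abel
  · obtain ⟨m, hm⟩ := hv g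
    change f (c g) = σ (φ g) v - v + N • m at hm
    have h1 : f (d g - c g) = N • (s - σ (φ g) s - m) := by
      rw [map_sub, hd, hm, map_sub, map_zsmul, smul_sub, smul_sub]
      abel
    -- Since `P'` is torsion-free, the congruence modulo `N` in `P` already holds in `L`.
    have h2 : p (s - σ (φ g) s - m) = 0 := by
      refine hP'.smul_right_injective hN ?_
      change N • p _ = N • 0
      rw [← map_zsmul, ← h1, hpf, smul_zero]
    obtain ⟨x, hx⟩ := (hex _).1 h2
    refine ⟨x, ?_⟩
    rw [← sub_eq_iff_eq_add']
    exact hf (by rw [h1, map_zsmul, hx])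

/-- For a quasi-invertible lattice, a cocycle modulo `N` that is locally a coboundary modulo `N`
lifts to a cocycle. -/
theorem IsQuasiInvertible.exists_cocycle (h : IsQuasiInvertible ρ) {N : ℤ} (hN : N ≠ 0)
    {c : Γ → L} (hc : ∀ g h, ∃ m, c (g * h) = c g + ρ (φ g) (c h) + N • m)
    (hloc : ∀ g, ∃ z m, c g = ρ (φ g) z - z + N • m) :
    ∃ d : Γ → L, (∀ g h, d (g * h) = d g + ρ (φ g) (d h)) ∧ ∀ g, ∃ m, d g = c g + N • m := by
  obtain ⟨L', _, _, _, ρ', h⟩ := h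
  obtain ⟨d, hd, hdc⟩ := h.exists_cocycle φ hN (c := fun g => (c g, (0 : L')))
    (fun g h => by
      obtain ⟨m, hm⟩ := hc g h
      exact ⟨(m, 0), by ext <;> simp [hm]⟩)
    (fun g => by
      obtain ⟨z, m, hm⟩ := hloc g
      exact ⟨(z, 0), (m, 0), by ext <;> simp [hm]⟩)
  refine ⟨fun g => (d g).1, fun g h => congrArg Prod.fst (hd g h), fun g => ?_⟩
  obtain ⟨m, hm⟩ := hdc g
  exact ⟨m.1, congrArg Prod.fst hm⟩

end GLattice

namespace BDDiagram

variable {m : ℕ} (Δ : Fin m → Component)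

/-! ### Sign changes -/

/-- The sign change `ε_s ↦ f s • ε_s`. -/
def signChange : (Idx Δ → ℤˣ) →* (Space Δ ≃ₗ[ℚ] Space Δ) where
  toFun f :=
    { toFun := fun x s => ((f s : ℤ) : ℚ) * x s
      invFun := fun x s => ((f s : ℤ) : ℚ) * x s
      map_add' := fun x y => by ext; simp [mul_add]
      map_smul' := fun r x => by ext; simp [mul_left_comm]
      left_inv := fun x => by
        ext s
        rcases Int.units_eq_one_or (f s) with h | h <;> simp [h]
      right_inv := fun x => by
        ext s
        rcases Int.units_eq_one_or (f s) with h | h <;> simp [h] }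
  map_one' := by ext; simp
  map_mul' f g := by ext; simp [mul_assoc]

@[simp]
theorem signChange_apply (f : Idx Δ → ℤˣ) (x : Space Δ) (s : Idx Δ) :
    signChange Δ f x s = ((f s : ℤ) : ℚ) * x s := rfl

theorem signChange_mulSingle_mem {i : Fin m} (hi : (Δ i).IsB) (s : Fin (Δ i).rank) (a : ℤˣ) :
    signChange Δ (Pi.mulSingle ⟨i, s⟩ a) ∈ weylGroup Δ := by
  rcases Int.units_eq_one_or a with rfl | rfl
  · simp
  refine Subgroup.subset_closure ⟨ε Δ ⟨i, s⟩, Or.inr ⟨i, s, 1, hi, by simp⟩, fun x => ?_⟩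
  ext t
  by_cases h : t = ⟨i, s⟩
  · subst h
    simp [ε]
    ring
  · simp [ε, h]

/-- Here `(α, α) = 2`, so the coefficient is `(x, α)`. The case `b = -1` is a transposition, `b = 1`
a transposition with both signs changed. -/
theorem mem_weylGroup_of_reflection {i : Fin m} {s t : Fin (Δ i).rank} (hst : s ≠ t) (b : ℤˣ)
    {w : Space Δ ≃ₗ[ℚ] Space Δ}
    (hw : ∀ x, w x = x - (x ⟨i, s⟩ + ((b : ℤ) : ℚ) * x ⟨i, t⟩) •
      (ε Δ ⟨i, s⟩ + ((b : ℤ) : ℚ) • ε Δ ⟨i, t⟩)) : w ∈ weylGroup Δ := by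
  refine Subgroup.subset_closure ⟨ε Δ ⟨i, s⟩ + ((b : ℤ) : ℚ) • ε Δ ⟨i, t⟩,
    Or.inl ⟨i, s, t, 1, b, hst, by simp⟩, fun x => ?_⟩
  rw [hw]
  have h1 : (⟨i, s⟩ : Idx Δ) ≠ ⟨i, t⟩ := by simpa using hst
  congr 2
  rcases Int.units_eq_one_or b with rfl | rfl <;> simp [ε, h1, h1.symm] <;> ring

/-- The permutation of the `ε_s` given by a permutation of the index set. -/
def permute : Equiv.Perm (Idx Δ) →* (Space Δ ≃ₗ[ℚ] Space Δ) where
  toFun e := LinearEquiv.funCongrLeft ℚ ℚ e.symm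
  map_one' := rfl
  map_mul' _ _ := rfl

@[simp]
theorem permute_apply (e : Equiv.Perm (Idx Δ)) (x : Space Δ) (s : Idx Δ) :
    permute Δ e x s = x (e.symm s) := rfl

theorem permute_swap_mem {i : Fin m} {s t : Fin (Δ i).rank} (hst : s ≠ t) :
    permute Δ (Equiv.swap ⟨i, s⟩ ⟨i, t⟩) ∈ weylGroup Δ := by
  refine mem_weylGroup_of_reflection Δ hst (-1) fun x => ?_
  have h1 : (⟨i, s⟩ : Idx Δ) ≠ ⟨i, t⟩ := by simpa using hst
  generalize (⟨i, s⟩ : Idx Δ) = s' at h1 ⊢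
  generalize (⟨i, t⟩ : Idx Δ) = t' at h1 ⊢
  ext r
  rw [permute_apply, Equiv.symm_swap]
  by_cases hs : r = s'
  · subst hs
    simp [ε, h1]
  · by_cases ht : r = t'
    · subst ht
      simp [ε, hs]
    · simp [ε, hs, ht, Equiv.swap_apply_of_ne_of_ne]

theorem signChange_pair_mem {i : Fin m} (s t : Fin (Δ i).rank) (a : ℤˣ) :
    signChange Δ (Pi.mulSingle ⟨i, s⟩ a * Pi.mulSingle ⟨i, t⟩ a) ∈ weylGroup Δ := by
  rcases Int.units_eq_one_or a with rfl | rfl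
  · simp
  by_cases hst : s = t
  · subst hst
    rw [← Pi.mulSingle_mul]
    simp
  · have h1 : (⟨i, s⟩ : Idx Δ) ≠ ⟨i, t⟩ := by simpa using hst
    rw [← mul_inv_cancel_right (signChange Δ _) (permute Δ (Equiv.swap ⟨i, s⟩ ⟨i, t⟩))]
    refine mul_mem (mem_weylGroup_of_reflection Δ hst 1 fun x => ?_)
      (inv_mem (permute_swap_mem Δ hst))
    generalize (⟨i, s⟩ : Idx Δ) = s' at h1 ⊢
    generalize (⟨i, t⟩ : Idx Δ) = t' at h1 ⊢
    ext r
    rw [LinearEquiv.mul_apply, signChange_apply, permute_apply, Equiv.symm_swap]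
    by_cases hs : r = s'
    · subst hs
      simp [ε, h1]
    · by_cases ht : r = t'
      · subst ht
        simp [ε, hs]
      · simp [ε, hs, ht, Equiv.swap_apply_of_ne_of_ne]

/-- A sign change whose number of signs on every component of type `D` is even lies in the Weyl
group. -/
theorem signChange_mem {f : Idx Δ → ℤˣ} (hf : ∀ i, ¬ (Δ i).IsB → ∏ s, f ⟨i, s⟩ = 1) :
    signChange Δ f ∈ weylGroup Δ := by
  change f ∈ (weylGroup Δ).comap (signChange Δ)
  have key : ∀ i, ∏ s, Pi.mulSingle (⟨i, s⟩ : Idx Δ) (f ⟨i, s⟩) ∈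
      (weylGroup Δ).comap (signChange Δ) := by
    intro i
    by_cases hi : (Δ i).IsB
    · exact Subgroup.prod_mem _ fun s _ => signChange_mulSingle_mem Δ hi s _
    · rcases isEmpty_or_nonempty (Fin (Δ i).rank) with h | ⟨⟨t⟩⟩
      · simp
      -- The added factors at the fixed index `t` multiply to `∏ f = 1`, which turns `f` into a
      -- product of paired sign changes.
      have h1 : ∏ s, Pi.mulSingle (⟨i, s⟩ : Idx Δ) (f ⟨i, s⟩) =
          ∏ s, (Pi.mulSingle (⟨i, s⟩ : Idx Δ) (f ⟨i, s⟩) *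
            Pi.mulSingle (M := fun _ : Idx Δ => ℤˣ) ⟨i, t⟩ (f ⟨i, s⟩)) := by
        rw [Finset.prod_mul_distrib]
        have h2 := map_prod (MonoidHom.mulSingle (fun _ : Idx Δ => ℤˣ) ⟨i, t⟩)
          (fun s => f ⟨i, s⟩) Finset.univ
        rw [hf i hi, map_one] at h2
        simp only [MonoidHom.mulSingle_apply] at h2
        rw [← h2, mul_one]
      rw [h1]
      exact Subgroup.prod_mem _ fun s _ => signChange_pair_mem Δ s t _
  rw [← Finset.univ_prod_mulSingle f, Fintype.prod_sigma]
  exact Subgroup.prod_mem _ fun i _ => key i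

/-! ### Lattice elements -/

@[simp]
theorem coe_latticeRep_apply (w : weylGroup Δ) (x : M Δ) :
    (latticeRep Δ w x : Space Δ) = (w : Space Δ ≃ₗ[ℚ] Space Δ) x := rfl

theorem exists_int_sub {x : Space Δ} (hx : x ∈ M Δ) (s t : Idx Δ) : ∃ n : ℤ, x s - x t = n := by
  obtain ⟨k, c, h⟩ := coord_of_mem Δ hx
  exact ⟨c s - c t, by rw [h, h]; push_cast; ring⟩

theorem β_mem : β Δ ∈ M Δ := Submodule.subset_span (Set.mem_insert _ _)

theorem mem_of_int (c : Idx Δ → ℤ) : (fun s => (c s : ℚ)) ∈ M Δ := by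
  have h : (fun s => (c s : ℚ)) = ∑ s, c s • ε Δ s := by
    ext t
    simp [ε, Finset.sum_apply, Pi.single_apply]
  rw [h]
  exact sum_mem fun s _ => (M Δ).smul_mem _ (ε_mem Δ s)

/-! ### The Klein four-group -/

/-- The three nontrivial characters of the Klein four-group. -/
def kleinCharacter : Fin 3 → ℤˣ × ℤˣ →* ℤˣ :=
  ![MonoidHom.fst _ _, MonoidHom.snd _ _, MonoidHom.fst _ _ * MonoidHom.snd _ _]

/-- A labelling of the index set embeds the Klein four-group into the Weyl group, and the
restriction of the lattice to it is not quasi-invertible. -/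
theorem not_isQuasiInvertible_of_labelling {u : Idx Δ → Fin 3} (hu : Function.Surjective u)
    (hprod : ∀ i, ¬ (Δ i).IsB → ∀ g, ∏ s, kleinCharacter (u ⟨i, s⟩) g = 1) :
    ¬ GLattice.IsQuasiInvertible (latticeRep Δ) := by
  intro hM
  let φ : ℤˣ × ℤˣ →* weylGroup Δ :=
    ((signChange Δ).comp (MonoidHom.pi fun s => kleinCharacter (u s))).codRestrict _
      fun g => signChange_mem Δ fun i hi => hprod i hi g
  have hφ : ∀ g (x : M Δ) s, (latticeRep Δ (φ g) x : Space Δ) s =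
      ((kleinCharacter (u s) g : ℤ) : ℚ) * (x : Space Δ) s := fun _ _ _ => rfl
  let w : M Δ := ⟨fun s => ((if u s = 2 then 1 else 0 : ℤ) : ℚ), mem_of_int Δ _⟩
  have hw : ∀ s, (w : Space Δ) s = if u s = 2 then 1 else 0 := fun s => by simp [w]
  let b : M Δ := ⟨β Δ, β_mem Δ⟩
  have hb : ∀ s, (b : Space Δ) s = 1 / 2 := β_apply Δ
  let c : ℤˣ × ℤˣ → M Δ := fun g => (1 - (g.1 : ℤ)) • w
  have hcw : ∀ g s, (c g : Space Δ) s = (1 - ((g.1 : ℤ) : ℚ)) * (w : Space Δ) s :=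
    fun g s => by simp [c]
  have ext' : ∀ {x y : M Δ}, (∀ s, (x : Space Δ) s = (y : Space Δ) s) → x = y :=
    fun h => Subtype.ext (funext h)
  have hχ0 : ∀ g, kleinCharacter 0 g = g.1 := fun _ => rfl
  have hχ1 : ∀ g, kleinCharacter 1 g = g.2 := fun _ => rfl
  have hχ2 : ∀ g, kleinCharacter 2 g = g.1 * g.2 := fun _ => rfl
  have hunit : ∀ e : ℤˣ, ∃ q : ℤ, ((e : ℤ) : ℚ) = 1 - 2 * q := fun e => by
    rcases Int.units_eq_one_or e with rfl | rfl
    · exact ⟨0, by simp⟩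
    · exact ⟨1, by norm_num⟩
  obtain ⟨d, hd, hdc⟩ := hM.exists_cocycle φ (N := 4) (by norm_num) (c := c)
    (fun g h => by
      obtain ⟨p, hp⟩ := hunit g.2
      obtain ⟨q, hq⟩ := hunit h.1
      -- The cocycle defect is `g₁ (1 - g₂) (1 - h₁) w`, and both brackets are even.
      refine ⟨((g.1 : ℤ) * p * q) • w, ext' fun s => ?_⟩
      simp only [Submodule.coe_add, Submodule.coe_smul, Pi.add_apply, Pi.smul_apply, hcw, hφ, hw]
      by_cases hs : u s = 2
      · simp [hs, hχ2, hp, hq]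
        ring
      · simp [hs])
    (fun ⟨a, a'⟩ => by
      rcases Int.units_eq_one_or a with rfl | rfl
      · exact ⟨0, 0, by simp [c]⟩
      · rcases Int.units_eq_one_or a' with rfl | rfl
        · refine ⟨-w, 0, ext' fun s => ?_⟩
          simp only [Submodule.coe_add, Submodule.coe_sub, Submodule.coe_neg, Submodule.coe_smul,
            Pi.add_apply, Pi.sub_apply, Pi.neg_apply, Pi.smul_apply, hcw, hφ, hw]
          by_cases hs : u s = 2
          · simp [hs, hχ2]
          · simp [hs]
        -- This element fixes label 2 and negates labels 0 and 1, so `2β` moves by `-2` exactly on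
        -- the latter; adding `4β` gives `2w`.
        · refine ⟨2 • b, b, ext' fun s => ?_⟩
          simp only [Submodule.coe_add, Submodule.coe_sub, Submodule.coe_smul,
            Pi.add_apply, Pi.sub_apply, Pi.smul_apply, hcw, hφ, hw, hb]
          obtain hs | hs | hs : u s = 0 ∨ u s = 1 ∨ u s = 2 := by
            generalize u s = k
            revert k
            decide
          all_goals simp [hs, hχ0, hχ1, hχ2, hb]; norm_num)
  have hd' : ∀ g h s, (d (g * h) : Space Δ) s =
      (d g : Space Δ) s + ((kleinCharacter (u s) g : ℤ) : ℚ) * (d h : Space Δ) s := fun g h s => by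
    rw [hd, ← hφ]
    rfl
  obtain ⟨s0, h0⟩ := hu 0
  obtain ⟨s1, h1⟩ := hu 1
  obtain ⟨s2, h2⟩ := hu 2
  have hone : ∀ s, (d 1 : Space Δ) s = 0 := fun s => by
    have := hd' 1 1 s
    simp at this
    exact this
  obtain ⟨x, hx⟩ := hdc (1, -1)
  obtain ⟨y, hy⟩ := hdc (-1, 1)
  have hx' : ∀ s, (d (1, -1) : Space Δ) s = 4 * (x : Space Δ) s := fun s => by
    rw [hx]
    simp [c]
  have hy' : ∀ s, (d (-1, 1) : Space Δ) s = 2 * (w : Space Δ) s + 4 * (y : Space Δ) s :=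
    fun s => by
      rw [hy]
      simp [hcw]
      norm_num
  -- Involutivity kills `x` at `s0` and `y` at `s1`; commutation at `s2` gives `4x = 2 + 4y` there,
  -- impossible as coordinate differences are integers.
  have e0 := hd' (1, -1) (1, -1) s0
  have e1 := hd' (-1, 1) (-1, 1) s1
  have e2 := hd' (1, -1) (-1, 1) s2
  have e3 := hd' (-1, 1) (1, -1) s2
  rw [mul_comm, e2] at e3
  rw [show ((1, -1) : ℤˣ × ℤˣ) * (1, -1) = 1 from rfl, hone, hx'] at e0
  rw [show ((-1, 1) : ℤˣ × ℤˣ) * (-1, 1) = 1 from rfl, hone, hy'] at e1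
  simp only [hx', hy', h0, h1, h2, hχ0, hχ1, hχ2, hw,
    if_neg (show (1 : Fin 3) ≠ 2 by decide)] at e0 e1 e3
  obtain ⟨n, hn⟩ := exists_int_sub Δ x.2 s2 s0
  obtain ⟨k, hk⟩ := exists_int_sub Δ y.2 s2 s1
  norm_num at e0 e1 e3
  have e4 : 2 * n = 1 + 2 * k := by
    have : (2 * n : ℚ) = 1 + 2 * k := by linarith
    exact_mod_cast this
  omega

/-! ### Existence of labellings -/

/-- The product is trivial exactly when the three label counts have equal parity: `2, 2, l - 4` or
`1, 1, l - 2`. For `l = 4` no such counts are all positive. -/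
theorem exists_label {l : ℕ} (hl : 3 ≤ l) : ∃ u : Fin l → Fin 3,
    (∀ g, ∏ s, kleinCharacter (u s) g = 1) ∧ (∃ s, u s = 0) ∧ (∃ s, u s = 1) ∧
      (l ≠ 4 → ∃ s, u s = 2) := by
  have hχ : ∀ (k : Fin 3) (n : ℕ) g, kleinCharacter k g ^ (2 * n) = 1 := fun k n g => by
    rw [pow_mul, Int.units_sq, one_pow]
  rcases Nat.even_or_odd' l with ⟨n, rfl | rfl⟩
  · obtain ⟨j, rfl⟩ : ∃ j, n = j + 2 := ⟨n - 2, by omega⟩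
    refine ⟨fun s => if s.val < 2 then 0 else if s.val < 4 then 1 else 2, fun g => ?_,
      ⟨⟨0, by omega⟩, rfl⟩, ⟨⟨2, by omega⟩, rfl⟩, fun h => ⟨⟨4, by omega⟩, rfl⟩⟩
    change ∏ s : Fin (2 * j + 1 + 1 + 1 + 1), _ = _
    simp only [Fin.prod_univ_succ, Fin.val_succ]
    simp [hχ, show ∀ k : ℕ, ¬ k + 1 + 1 + 1 + 1 < 4 by omega]
  · obtain ⟨j, rfl⟩ : ∃ j, n = j + 1 := ⟨n - 1, by omega⟩
    refine ⟨fun s => if s.val < 1 then 0 else if s.val < 2 then 1 else 2, fun g => ?_,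
      ⟨⟨0, by omega⟩, rfl⟩, ⟨⟨1, by omega⟩, rfl⟩, fun h => ⟨⟨2, by omega⟩, rfl⟩⟩
    change ∏ s : Fin (2 * j + 1 + 1 + 1), _ = _
    simp only [Fin.prod_univ_succ, Fin.val_succ]
    simp [pow_succ, pow_mul]
    revert g
    decide

theorem Component.three_le_rank {C : Component} (hC : ¬ C.IsB) : 3 ≤ C.rank := by
  cases C with
  | B l hl => exact absurd trivial hC
  | D l hl => exact hl

theorem Component.rank_pos (C : Component) : 0 < C.rank := by
  cases C with
  | B l hl => exact hl
  | D l hl => exact Nat.lt_of_lt_of_le (by norm_num) hl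

theorem surjective_fin_three {α : Type*} {u : α → Fin 3} (h0 : ∃ s, u s = 0) (h1 : ∃ s, u s = 1)
    (h2 : ∃ s, u s = 2) : Function.Surjective u := fun k => by
  fin_cases k
  exacts [h0, h1, h2]

/-- Unless the diagram is a single component of type `D_4`, there is a labelling to which
`not_isQuasiInvertible_of_labelling` applies. -/
theorem exists_labelling (hΔ : 3 ≤ card Δ) :
    (∃ u : Idx Δ → Fin 3, Function.Surjective u ∧
      ∀ i, ¬ (Δ i).IsB → ∀ g, ∏ s, kleinCharacter (u ⟨i, s⟩) g = 1) ∨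
    ∃ i, ¬ (Δ i).IsB ∧ (Δ i).rank = 4 ∧ ∀ j, j = i := by
  by_cases hB : ∀ i, (Δ i).IsB
  · left
    have hcard : Fintype.card (Fin 3) ≤ Fintype.card (Idx Δ) := by
      simpa [card] using hΔ
    obtain ⟨f⟩ := Function.Embedding.nonempty_of_card_le hcard
    exact ⟨Function.invFun f, Function.invFun_surjective f.injective,
      fun i hi => absurd (hB i) hi⟩
  push Not at hB
  by_cases h4 : ∃ i, ¬ (Δ i).IsB ∧ (Δ i).rank ≠ 4
  · left
    obtain ⟨i, hi, hi4⟩ := h4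
    have hv : ∀ j, ∃ v : Fin (Δ j).rank → Fin 3, ¬ (Δ j).IsB →
        (∀ g, ∏ s, kleinCharacter (v s) g = 1) ∧ (∃ s, v s = 0) ∧ (∃ s, v s = 1) ∧
          ((Δ j).rank ≠ 4 → ∃ s, v s = 2) := fun j => by
      by_cases hj : (Δ j).IsB
      · exact ⟨fun _ => 2, fun h => absurd hj h⟩
      · obtain ⟨v, hv⟩ := exists_label (Component.three_le_rank hj)
        exact ⟨v, fun _ => hv⟩
    choose v hv using hv
    obtain ⟨-, ⟨s0, h0⟩, ⟨s1, h1⟩, h2⟩ := hv i hi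
    obtain ⟨s2, h2⟩ := h2 hi4
    exact ⟨fun p => v p.1 p.2,
      surjective_fin_three ⟨⟨i, s0⟩, h0⟩ ⟨⟨i, s1⟩, h1⟩ ⟨⟨i, s2⟩, h2⟩, fun j hj => (hv j hj).1⟩
  push Not at h4
  obtain ⟨i, hi⟩ := hB
  by_cases hij : ∀ j, j = i
  · exact Or.inr ⟨i, hi, h4 i hi, hij⟩
  left
  push Not at hij
  obtain ⟨j, hj⟩ := hij
  have hv : ∀ k, ∃ v : Fin (Δ k).rank → Fin 3,
      (¬ (Δ k).IsB → ∀ g, ∏ s, kleinCharacter (v s) g = 1) ∧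
        (k = i → (∃ s, v s = 0) ∧ (∃ s, v s = 1)) ∧ (k ≠ i → ∀ s, v s = 2) := fun k => by
    by_cases hk : k = i
    · subst hk
      obtain ⟨v, hv⟩ := exists_label (Component.three_le_rank hi)
      exact ⟨v, fun _ => hv.1, fun _ => ⟨hv.2.1, hv.2.2.1⟩, fun h => absurd rfl h⟩
    -- Every other `D` component is a `D_4`, and the fourth power of a sign character is trivial.
    · refine ⟨fun _ => 2, fun hkB g => ?_, fun h => absurd h hk, fun _ _ => rfl⟩
      rw [Finset.prod_const, Finset.card_univ, Fintype.card_fin, h4 k hkB, pow_mul _ 2 2,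
        Int.units_sq]
  choose v hv using hv
  obtain ⟨⟨s0, h0⟩, s1, h1⟩ := (hv i).2.1 rfl
  exact ⟨fun p => v p.1 p.2, surjective_fin_three ⟨⟨i, s0⟩, h0⟩ ⟨⟨i, s1⟩, h1⟩
    ⟨⟨j, ⟨0, (Δ j).rank_pos⟩⟩, (hv j).2.2 hj _⟩, fun k hk => (hv k).1 hk⟩

end BDDiagram

/-! ### A single `D_4` and the quaternion group -/

/-- Two elements satisfying the relations of the quaternion group define a homomorphism. -/
theorem QuaternionGroup.exists_hom {E : Type*} [Group E] {n : ℕ} [NeZero n] {x y : E}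
    (hx : x ^ (2 * n) = 1) (hy : y * y = x ^ n) (hxy : x * y * x = y) :
    ∃ φ : QuaternionGroup n →* E, (∀ k, φ (.a k) = x ^ k.val) ∧ ∀ k, φ (.xa k) = y * x ^ k.val := by
  have hadd : ∀ k l : ZMod (2 * n), x ^ (k + l).val = x ^ k.val * x ^ l.val := fun k l => by
    rw [ZMod.val_add, ← pow_add, ← pow_mod_orderOf,
      Nat.mod_mod_of_dvd _ (orderOf_dvd_of_pow_eq_one hx), pow_mod_orderOf]
  have hsub : ∀ k l : ZMod (2 * n), x ^ (k - l).val = (x ^ l.val)⁻¹ * x ^ k.val := fun k l => by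
    rw [eq_inv_mul_iff_mul_eq, ← hadd, add_sub_cancel]
  have hn : x ^ (n : ZMod (2 * n)).val = x ^ n := by
    rw [ZMod.val_natCast, Nat.mod_eq_of_lt]
    have := NeZero.pos n
    omega
  have hcomm : ∀ k : ℕ, x ^ k * y = y * (x ^ k)⁻¹ := fun k => by
    induction k with
    | zero => simp
    | succ k ih =>
      rw [pow_succ, mul_assoc, eq_mul_inv_of_mul_eq hxy, ← mul_assoc, ih, mul_assoc,
        ← mul_inv_rev, ← pow_succ', pow_succ]
  refine ⟨MonoidHom.mk' (fun q => match q with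
    | .a k => x ^ k.val
    | .xa k => y * x ^ k.val) ?_, fun _ => rfl, fun _ => rfl⟩
  rintro (k | k) (l | l)
  · exact hadd k l
  · change y * x ^ (l - k).val = x ^ k.val * (y * x ^ l.val)
    rw [hsub, ← mul_assoc, ← mul_assoc, hcomm]
  · change y * x ^ (k + l).val = y * x ^ k.val * x ^ l.val
    rw [hadd, mul_assoc]
  · change x ^ (n + l - k : ZMod (2 * n)).val = y * x ^ k.val * (y * x ^ l.val)
    have hk : y * x ^ k.val = (x ^ k.val)⁻¹ * y := by
      rw [eq_inv_mul_iff_mul_eq, ← mul_assoc, hcomm, inv_mul_cancel_right]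
    rw [hsub, hadd, hn, ← hy, hk]
    simp only [mul_assoc]

namespace BDDiagram

variable {m : ℕ} (Δ : Fin m → Component)

/-- Left multiplication by the quaternion `i` on the lattice of type `D_4`. -/
theorem exists_mulI {i : Fin m} {p : Fin 4 → Fin (Δ i).rank} (hp : Function.Injective p) :
    ∃ w ∈ weylGroup Δ, ∀ x, w x ⟨i, p 0⟩ = -x ⟨i, p 1⟩ ∧ w x ⟨i, p 1⟩ = x ⟨i, p 0⟩ ∧
      w x ⟨i, p 2⟩ = -x ⟨i, p 3⟩ ∧ w x ⟨i, p 3⟩ = x ⟨i, p 2⟩ := by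
  have hne : ∀ {k l : Fin 4}, k ≠ l → p k ≠ p l := fun h => hp.ne h
  refine ⟨_, mul_mem (signChange_pair_mem Δ (p 0) (p 2) (-1)) (mul_mem
    (permute_swap_mem Δ (hne (show (0 : Fin 4) ≠ 1 by decide)))
    (permute_swap_mem Δ (hne (show (2 : Fin 4) ≠ 3 by decide)))), fun x => ?_⟩
  simp [LinearEquiv.mul_apply, Equiv.swap_apply_def, hp.eq_iff]

/-- Left multiplication by the quaternion `j` on the lattice of type `D_4`. -/
theorem exists_mulJ {i : Fin m} {p : Fin 4 → Fin (Δ i).rank} (hp : Function.Injective p) :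
    ∃ w ∈ weylGroup Δ, ∀ x, w x ⟨i, p 0⟩ = -x ⟨i, p 2⟩ ∧ w x ⟨i, p 1⟩ = x ⟨i, p 3⟩ ∧
      w x ⟨i, p 2⟩ = x ⟨i, p 0⟩ ∧ w x ⟨i, p 3⟩ = -x ⟨i, p 1⟩ := by
  have hne : ∀ {k l : Fin 4}, k ≠ l → p k ≠ p l := fun h => hp.ne h
  refine ⟨_, mul_mem (signChange_pair_mem Δ (p 0) (p 3) (-1)) (mul_mem
    (permute_swap_mem Δ (hne (show (0 : Fin 4) ≠ 2 by decide)))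
    (permute_swap_mem Δ (hne (show (1 : Fin 4) ≠ 3 by decide)))), fun x => ?_⟩
  simp [LinearEquiv.mul_apply, Equiv.swap_apply_def, hp.eq_iff]

/-- The lattice of a single component of type `D_4` is not quasi-invertible, by restriction to a
quaternion subgroup of the Weyl group. -/
theorem not_isQuasiInvertible_of_card_eq_four {i : Fin m} (hi : ¬ (Δ i).IsB)
    (hrank : (Δ i).rank = 4) (huniq : ∀ j, j = i) :
    ¬ GLattice.IsQuasiInvertible (latticeRep Δ) := by
  intro hM
  let p : Fin 4 ≃ Fin (Δ i).rank := finCongr hrank.symm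
  let q : Fin 4 → Idx Δ := fun k => ⟨i, p k⟩
  have hq : Function.Bijective q := by
    refine ⟨fun k l h => p.injective (by simpa [q] using h), ?_⟩
    rintro ⟨j, s⟩
    obtain rfl := huniq j
    exact ⟨p.symm s, by simp [q]⟩
  let e : Fin 4 ≃ Idx Δ := Equiv.ofBijective q hq
  obtain ⟨I, hIW, hI⟩ := exists_mulI Δ p.injective
  obtain ⟨J, hJW, hJ⟩ := exists_mulJ Δ p.injective
  have hI : ∀ x, I x (e 0) = -x (e 1) ∧ I x (e 1) = x (e 0) ∧ I x (e 2) = -x (e 3) ∧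
    I x (e 3) = x (e 2) := hI
  have hJ : ∀ x, J x (e 0) = -x (e 2) ∧ J x (e 1) = x (e 3) ∧ J x (e 2) = x (e 0) ∧
    J x (e 3) = -x (e 1) := hJ
  have extE : ∀ {x y : Space Δ}, (∀ k, x (e k) = y (e k)) → x = y := fun {x y} h => by
    ext s
    simpa using h (e.symm s)
  have hII : I * I = LinearEquiv.neg ℚ := LinearEquiv.ext fun x => extE fun k => by
    fin_cases k <;> simp [hI]
  have hJJ : J * J = LinearEquiv.neg ℚ := LinearEquiv.ext fun x => extE fun k => by
    fin_cases k <;> simp [hJ]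
  have hIJI : I * J * I = J := LinearEquiv.ext fun x => extE fun k => by
    fin_cases k <;> simp [hI, hJ]
  obtain ⟨φ, hφa, hφx⟩ := QuaternionGroup.exists_hom (n := 2) (x := (⟨I, hIW⟩ : weylGroup Δ))
    (y := ⟨J, hJW⟩)
    (Subtype.ext (by
      change I ^ 4 = 1
      rw [pow_mul I 2 2, sq I, hII]
      ext
      simp [sq]))
    (Subtype.ext (by
      change J * J = I ^ 2
      rw [sq, hII, hJJ]))
    (Subtype.ext hIJI)
  let vec : (Fin 4 → ℤ) → M Δ := fun v => ⟨fun s => (v (e.symm s) : ℚ), mem_of_int Δ _⟩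
  have hvec : ∀ v k, (vec v : Space Δ) (e k) = v k := fun v k => by simp [vec]
  let b : M Δ := ⟨β Δ, β_mem Δ⟩
  have hb : ∀ k, (b : Space Δ) (e k) = 1 / 2 := fun k => β_apply Δ _
  -- `w = 1 + i` generates the two-sided ideal above 2 of the Hurwitz order, and `t` modulo 2 is the
  -- character with kernel `⟨i⟩`.
  let w : M Δ := vec ![1, 1, 0, 0]
  let t : QuaternionGroup 2 → ℤ := fun g => match g with
    | .a _ => 0
    | .xa _ => 1
  have ht : ∀ g h, ∃ n, t (g * h) = t g + t h + 2 * n := by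
    rintro (k | k) (l | l)
    · exact ⟨0, rfl⟩
    · exact ⟨0, rfl⟩
    · exact ⟨0, rfl⟩
    · exact ⟨-1, rfl⟩
  have extM : ∀ {x y : M Δ}, (∀ k, (x : Space Δ) (e k) = (y : Space Δ) (e k)) → x = y :=
    fun h => Subtype.ext (extE h)
  have hstable : ∀ g, ∃ n, latticeRep Δ (φ g) w = w + (2 : ℤ) • n := by
    have hmul : ∀ {x y : weylGroup Δ}, (∃ n, latticeRep Δ x w = w + (2 : ℤ) • n) →
        (∃ n, latticeRep Δ y w = w + (2 : ℤ) • n) →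
        ∃ n, latticeRep Δ (x * y) w = w + (2 : ℤ) • n := by
      rintro x y ⟨n, hn⟩ ⟨k, hk⟩
      refine ⟨n + latticeRep Δ x k, ?_⟩
      rw [map_mul, Module.End.mul_apply, hk, map_add, map_zsmul, hn]
      module
    have hIw : ∃ n, latticeRep Δ ⟨I, hIW⟩ w = w + (2 : ℤ) • n := by
      refine ⟨vec ![-1, 0, 0, 0], extM fun k => ?_⟩
      fin_cases k <;> simp [hI, hvec, w]
      norm_num
    have hJw : ∃ n, latticeRep Δ ⟨J, hJW⟩ w = w + (2 : ℤ) • n := by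
      refine ⟨vec ![-1, -1, 0, -1] + b, extM fun k => ?_⟩
      fin_cases k <;> simp [hJ, hvec, w, hb] <;> norm_num
    have hpow : ∀ k : ℕ, ∃ n, latticeRep Δ (⟨I, hIW⟩ ^ k) w = w + (2 : ℤ) • n := fun k => by
      induction k with
      | zero => exact ⟨0, by simp⟩
      | succ k ih =>
        rw [pow_succ]
        exact hmul ih hIw
    rintro (k | k)
    · rw [hφa]
      exact hpow _
    · rw [hφx]
      exact hmul hJw (hpow _)
  have hxa : ∀ k (z : M Δ), (latticeRep Δ (φ (.xa k)) z : Space Δ) =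
      J ((I ^ k.val) (z : Space Δ)) := fun k z => by
    rw [coe_latticeRep_apply, hφx]
    rfl
  obtain ⟨d, hd, hdc⟩ := hM.exists_cocycle φ (N := 2) (by norm_num) (c := fun g => t g • w)
    (fun g h => by
      obtain ⟨n, hn⟩ := ht g h
      obtain ⟨k, hk⟩ := hstable g
      refine ⟨n • w - t h • k, ?_⟩
      rw [hn, map_zsmul, hk]
      module)
    (by
      -- The quaternion `j iᵏ - 1` has norm 2, so it generates the same ideal as `w`.
      have hloc : ∀ k, ∃ z n, w = latticeRep Δ (φ (.xa k)) z - z + (2 : ℤ) • n := fun k => by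
        obtain ⟨z, n, hzn⟩ : ∃ z n : M Δ, ∀ l, (w : Space Δ) (e l) =
            J ((I ^ k.val) (z : Space Δ)) (e l) - (z : Space Δ) (e l) +
              2 * (n : Space Δ) (e l) := by
          obtain hk | hk | hk | hk : k.val = 0 ∨ k.val = 1 ∨ k.val = 2 ∨ k.val = 3 := by
            have := ZMod.val_lt k
            omega
          · refine ⟨vec ![1, 0, 0, 0] + b, vec ![1, 0, -1, 0] + b, fun l => ?_⟩
            fin_cases l <;> simp [hk, hJ, hvec, hb, w] <;> norm_num
          · refine ⟨b, b, fun l => ?_⟩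
            fin_cases l <;> simp [hk, hI, hJ, hvec, hb, w] <;> norm_num
          · refine ⟨vec ![1, 0, 0, 0] + b, vec ![1, 1, 1, 0], fun l => ?_⟩
            fin_cases l <;> simp [hk, pow_succ, hI, hJ, hvec, hb, w] <;> norm_num
          · refine ⟨b, vec ![1, 1, 0, 0], fun l => ?_⟩
            fin_cases l <;> simp [hk, pow_succ, hI, hJ, hvec, hb, w] <;> norm_num
        exact ⟨z, n, extM fun l => by
          simp only [Submodule.coe_add, Submodule.coe_sub, Submodule.coe_smul, Pi.add_apply,
            Pi.sub_apply, Pi.smul_apply, hxa, hzn l]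
          simp⟩
      rintro (k | k)
      · exact ⟨0, 0, by simp [t]⟩
      · obtain ⟨z, n, h⟩ := hloc k
        exact ⟨z, n, by rw [← h]; exact one_smul _ _⟩)
  obtain ⟨x, hx⟩ := hdc (.a 2)
  obtain ⟨y, hy⟩ := hdc (.a 1)
  obtain ⟨z, hz⟩ := hdc (.xa 0)
  have hx : d (.a 2) = (2 : ℤ) • x := by rw [hx]; simp [t]
  have hneg : ∀ v : M Δ, latticeRep Δ (φ (.a 2)) v = -v := fun v => Subtype.ext (by
    rw [coe_latticeRep_apply, hφa]
    change (I ^ 2) (v : Space Δ) = -v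
    rw [sq, hII]
    rfl)
  have hcomm : ∀ g : QuaternionGroup 2, .a 2 * g = g * .a 2 := by decide
  -- Comparing `d` at `(-1) g` and `g (-1)` forces `d g = x - g x`.
  have hdx : ∀ g s, (d g : Space Δ) s = (x : Space Δ) s - (latticeRep Δ (φ g) x : Space Δ) s := by
    intro g s
    have h1 := hd (.a 2) g
    rw [hcomm, hd, hneg, hx, map_zsmul] at h1
    have h2 := congrFun (congrArg (fun v : M Δ => (v : Space Δ)) h1) s
    simp at h2
    rw [coe_latticeRep_apply]
    linarith
  -- `(1 - i) x ∈ 2M` puts `x` in the ideal of `1 + i`, so `(1 - j) x ∈ 2M`, yet it is `w` modulo 2.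
  -- In coordinates, `x₀ = y₀ - y₁` is an integer while `2x₀ = 1 + 2(z₀ - z₂)`.
  have hI0 := hdx (.a 1) (e 0)
  have hI1 := hdx (.a 1) (e 1)
  have hJ0 := hdx (.xa 0) (e 0)
  have hJ2 := hdx (.xa 0) (e 2)
  rw [coe_latticeRep_apply, hφa, hy] at hI0 hI1
  rw [hxa, hz] at hJ0 hJ2
  obtain ⟨n, hn⟩ := exists_int_sub Δ y.2 (e 0) (e 1)
  obtain ⟨k, hk⟩ := exists_int_sub Δ z.2 (e 0) (e 2)
  have hval : (1 : ZMod (2 * 2)).val = 1 := rfl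
  simp [t, hval, hI, hJ, hvec, w] at hI0 hI1 hJ0 hJ2
  have h : 2 * n = 1 + 2 * k := by
    have : (2 * n : ℚ) = 1 + 2 * k := by linarith
    exact_mod_cast this
  omega

end BDDiagram

theorem mainTheorem8 {m : ℕ} (Δ : Fin m → BDDiagram.Component) (hΔ : 3 ≤ BDDiagram.card Δ) :
    ¬ GLattice.IsQuasiInvertible (BDDiagram.latticeRep Δ) := by
  rcases BDDiagram.exists_labelling Δ hΔ with ⟨u, hu, hprod⟩ | ⟨i, hi, h4, huniq⟩
  · exact BDDiagram.not_isQuasiInvertible_of_labelling Δ hu hprod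
  · exact BDDiagram.not_isQuasiInvertible_of_card_eq_four Δ hi h4 huniq
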